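/- Let $\xi$ be a probability measure on $\{0,1,2,\dots\}$ with $\sum_{k\ge 0}k\,\xi(k)\le 1$ and $\xi(1)<1$, and for every $k\ge 0$ let $\eta^{(k)}$ be a probability measure on $\{-1,0,1\}^k$ (for $k=0$, the point mass at the empty vector). Let $\mathbb T_0$ be the set of finite rooted plane trees $t$ with vertex labels $\ell_t\in\mathbb Z$ such that the root has label $0$ and labels change by $-1$, $0$ or $1$ along every edge. For a vertex $v$ of $t$ let $k_t(v)$ be its number of children and $[v]_t\in\{-1,0,1\}^{k_t(v)}$ the vector of label increments from $v$ to its children, from left to right. Then $$\Pi_0(t)=\prod_{v\in V(t)}\xi(k_t(v))\,\eta^{(k_t(v))}([v]_t),\qquad t\in\mathbb T_0,$$ defines a probability measure on $\mathbb T_0$. Let $T$ be a random tree with law $\Pi_0$, with edges oriented from parent to child. For $k\ge 1$ let $X_k^+$ (resp. $X_k^-$) be the number of edges of $T$ from a vertex labelled $k-1$ to one labelled $k$ (resp. from $k$ to $k-1$), and let $\check X_k^+$ (resp. $\check X_k^-$) be the number of edges of $T$ from a vertex labelled $-k$ to one labelled $-k+1$ (resp. from $-k+1$ to $-k$). Each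 of the two processes $(\check X_k^-,\check X_k^+)_{k\ge 1}$ and $(X_k^+,X_k^-)_{k\ge 1}$ is a time-homogeneous Markov chain on $\{0,1,2,\dots\}^2$. If the displacement laws are symmetric, i.e. for every $k$ the image of $\eta^{(k)}$ under $x\mapsto -x$ is $\eta^{(k)}$, then these two processes have the same law. Moreover, conditionally on the value of $(X_1^+,X_1^-)$, the two processes are independent. -/

import Mathlib

open MeasureTheory ProbabilityTheory
open scoped ENNReal

/-- Finite rooted plane trees whose edges carry an increment in `{-1, 0, 1}` (this is `SignType`).
`node k δ c` is the tree whose root has `k` children listed from left to right, the `i`-th edge from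
the root carrying the increment `δ i` and leading to the root of the subtree `c i`.

For every integer `x`, such a tree is the same thing as a plane tree with integer vertex labels
whose root has label `x` and whose labels change by `-1`, `0` or `1` along every edge: the label of a
vertex is `x` plus the sum of the increments along its ancestral line. -/
inductive LabelledPlaneTree : Type
  | node (k : ℕ) (δ : Fin k → SignType) (c : Fin k → LabelledPlaneTree) : LabelledPlaneTree

namespace LabelledPlaneTree

/-- Every set of trees is measurable (there are countably many trees). -/
instance : MeasurableSpace LabelledPlaneTree := ⊤

/-- `edgeCount a b x t` is the number of edges of `t`, oriented from parent to child, that go from a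
vertex labelled `a` to a vertex labelled `b`, when the root of `t` has label `x`. -/
def edgeCount (a b : ℤ) : ℤ → LabelledPlaneTree → ℕ
  | x, node _ δ c =>
    ∑ i, ((if x = a ∧ x + (δ i : ℤ) = b then 1 else 0) + edgeCount a b (x + (δ i : ℤ)) (c i))

/-- The weight `∏ ξ(k(v)) η^{(k(v))}([v])` of a labelled tree, the product being over all vertices `v`,
with `k(v)` the number of children of `v` and `[v]` the vector of label increments from `v` to its
children. -/
noncomputable def weight (ξ : PMF ℕ) (η : ∀ k : ℕ, PMF (Fin k → SignType)) :
    LabelledPlaneTree → ℝ≥0∞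
  | node k δ c => ξ k * η k δ * ∏ i, weight ξ η (c i)

/-- The law of the labelled Galton-Watson tree with offspring distribution `ξ` and displacement
distributions `η`: the measure giving mass `weight ξ η t` to every tree `t`. -/
noncomputable def law (ξ : PMF ℕ) (η : ∀ k : ℕ, PMF (Fin k → SignType)) :
    Measure LabelledPlaneTree :=
  Measure.sum fun t => weight ξ η t • Measure.dirac t

/-- `X_m⁺`: the number of edges from label `m - 1` to label `m`, the root having label `0`. -/
def Xplus (m : ℕ) (t : LabelledPlaneTree) : ℕ := edgeCount (m - 1) m 0 t

/-- `X_m⁻`: the number of edges from label `m` to label `m - 1`, the root having label `0`. -/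
def Xminus (m : ℕ) (t : LabelledPlaneTree) : ℕ := edgeCount m (m - 1) 0 t

/-- `X̌_m⁺`: the number of edges from label `-m` to label `-m + 1`, the root having label `0`. -/
def XcheckPlus (m : ℕ) (t : LabelledPlaneTree) : ℕ := edgeCount (-m) (-m + 1) 0 t

/-- `X̌_m⁻`: the number of edges from label `-m + 1` to label `-m`, the root having label `0`. -/
def XcheckMinus (m : ℕ) (t : LabelledPlaneTree) : ℕ := edgeCount (-m + 1) (-m) 0 t

/-- The process `(X_k⁺, X_k⁻)_{k ≥ 1}`; the entry of index `j : ℕ` is the one with `k = j + 1`. -/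
def posProcess (t : LabelledPlaneTree) (j : ℕ) : ℕ × ℕ := (Xplus (j + 1) t, Xminus (j + 1) t)

/-- The process `(X̌_k⁻, X̌_k⁺)_{k ≥ 1}` (in this order of the signs); the entry of index `j : ℕ` is
the one with `k = j + 1`. -/
def negProcess (t : LabelledPlaneTree) (j : ℕ) : ℕ × ℕ :=
  (XcheckMinus (j + 1) t, XcheckPlus (j + 1) t)

end LabelledPlaneTree

/-- A process `Y` with values in a countable discrete space `S` is a time-homogeneous Markov chain
under `μ`: there is one transition kernel `K`, the same at all times, such that
`μ(Y₀ = y₀, …, Yₙ₊₁ = yₙ₊₁) = μ(Y₀ = y₀, …, Yₙ = yₙ) K(yₙ, yₙ₊₁)`. -/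
def IsTimeHomogeneousMarkovChain {Ω S : Type*} [MeasurableSpace Ω] (μ : Measure Ω)
    (Y : Ω → ℕ → S) : Prop :=
  ∃ K : S → PMF S, ∀ (n : ℕ) (y : ℕ → S),
    μ {ω | ∀ i ≤ n + 1, Y ω i = y i} = μ {ω | ∀ i ≤ n, Y ω i = y i} * K (y n) (y (n + 1))

/-- The displacement laws are symmetric: if `D` has law `η k`, then so has `-D`. -/
def SymmetricDisplacements (η : ∀ k : ℕ, PMF (Fin k → SignType)) : Prop :=
  ∀ k : ℕ, (η k).map (fun δ i => -δ i) = η k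

/-!
Cut a tree at its edges between the labels `0` and `1`. Pieces with labels at most `0` and pieces
with labels at least `1` alternate along its branches. Let `L` and `U` be the generating functions
of these pieces, in which one variable marks the cut edges, and let `p` and `q` mark the edges from
`0` to `1` and from `1` to `0`. If `V` is `p` times the generating function of the trees with root
label `1`, then `V = p U(q L(V))`. By Lagrange inversion, the generating function of the trees with
a given root label `x ≤ 0` is a sum over `y` of `p ^ y.1 * q ^ y.2` times a series in the edges
below `0` times a series in the edges above `1`, the latter not depending on `x`. Thus, given the
numbers `y` of cut edges, the edge counts below and above are independent. For `x = 0` this is the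
conditional independence, and for `x = -n` it is, after a shift of the labels, the Markov property
at time `n`; negating the increments exchanges the two processes.

The total mass is a fixed point of the generating function of `ξ` in `[0, 1]`, and by convexity the
only one is `1`.
-/

open Finset.HasAntidiagonal (antidiagonal mem_antidiagonal)
open MvPowerSeries (X)
open scoped NNReal

/-- Complete commutative semirings: every family, of whatever cardinality, has a sum, and these sums
satisfy the infinite associative, commutative and distributive laws. The coefficients of the
generating functions below live in `ℝ≥0∞`, so that no summability has to be checked. -/
class CompleteSemiring (R : Type*) [CommSemiring R] where
  isum : {ι : Type} → (ι → R) → R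
  isum_fintype : ∀ {ι : Type} [Fintype ι] (f : ι → R), isum f = ∑ i, f i
  isum_sigma : ∀ {ι : Type} {β : ι → Type} (f : (Σ i, β i) → R),
    isum f = isum fun i => isum fun b => f ⟨i, b⟩
  isum_equiv : ∀ {ι κ : Type} (e : ι ≃ κ) (f : κ → R), isum (fun i => f (e i)) = isum f
  mul_isum : ∀ {ι : Type} (a : R) (f : ι → R), a * isum f = isum fun i => a * f i

namespace CompleteSemiring

section Sums

variable {R : Type*} [CommSemiring R] [CompleteSemiring R] {ι κ : Type}

theorem isum_mul (a : R) (f : ι → R) : isum f * a = isum fun i => f i * a := by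
  simp only [mul_comm _ a, mul_isum]

theorem isum_zero : isum (fun _ : ι => (0 : R)) = 0 := by
  simpa only [zero_mul] using (mul_isum (0 : R) fun _ : ι => (0 : R)).symm

theorem isum_prod (f : ι × κ → R) : isum f = isum fun i => isum fun k => f (i, k) := by
  rw [← isum_equiv (Equiv.sigmaEquivProd ι κ) f, isum_sigma]
  rfl

theorem isum_comm (f : ι → κ → R) :
    (isum fun i => isum fun k => f i k) = isum fun k => isum fun i => f i k := by
  rw [← isum_prod fun x : ι × κ => f x.1 x.2, ← isum_prod fun x : κ × ι => f x.2 x.1,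
    ← isum_equiv (Equiv.prodComm κ ι)]
  rfl

theorem isum_add (f g : ι → R) : (isum fun i => f i + g i) = isum f + isum g := by
  have h := isum_comm fun i (b : Bool) => cond b (f i) (g i)
  simpa only [isum_fintype (ι := Bool), Fintype.sum_bool, cond_true, cond_false] using h

theorem isum_finset_sum {κ : Type*} (s : Finset κ) (f : ι → κ → R) :
    (isum fun i => ∑ k ∈ s, f i k) = ∑ k ∈ s, isum fun i => f i k := by
  classical
  induction s using Finset.induction_on with
  | empty => simp only [Finset.sum_empty, isum_zero]
  | insert k s hk ih => simp only [Finset.sum_insert hk, isum_add, ih]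

theorem isum_eq_single (a : ι) (f : ι → R) (h : ∀ i, i ≠ a → f i = 0) : isum f = f a := by
  classical
  have hsplit :
      isum f = isum (fun i : {i // i = a} => f i) + isum fun i : {i // ¬ i = a} => f i := by
    rw [← isum_equiv ((Equiv.sumEquivSigmaBool _ _).symm.trans (Equiv.sumCompl (· = a))),
      isum_sigma, isum_fintype, Fintype.sum_bool, add_comm]
    rfl
  have hzero : (isum fun i : {i // ¬ i = a} => f i) = 0 := by
    rw [← isum_zero (ι := {i // ¬ i = a})]
    exact congrArg isum (funext fun i => h i i.2)
  rw [hsplit, hzero, add_zero, isum_fintype, Fintype.sum_unique]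
  rfl

theorem isum_mul_isum (f : ι → R) (g : κ → R) :
    isum f * isum g = isum fun i => isum fun k => f i * g k := by
  simp only [mul_isum, isum_mul]
  exact isum_comm _

theorem prod_isum {k : ℕ} (f : Fin k → ι → R) :
    ∏ i, isum (f i) = isum fun c : Fin k → ι => ∏ i, f i (c i) := by
  induction k with
  | zero => simp [isum_fintype]
  | succ k ih =>
    rw [Fin.prod_univ_succ, ih, isum_mul_isum, ← isum_prod fun x : ι × (Fin k → ι) =>
      f 0 x.1 * ∏ i : Fin k, f i.succ (x.2 i),
      ← isum_equiv (Fin.consEquiv fun _ : Fin (k + 1) => ι)]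
    exact congrArg isum (funext fun x => by simp [Fin.prod_univ_succ, Fin.consEquiv])

theorem isum_antidiagonal {M : Type} [AddMonoid M] [Finset.HasAntidiagonal M] (f : M → M → R) :
    (isum fun i => isum fun j => f i j) = isum fun n => ∑ x ∈ antidiagonal n, f x.1 x.2 := by
  rw [← isum_prod fun x : M × M => f x.1 x.2,
    ← isum_equiv Finset.HasAntidiagonal.sigmaAntidiagonalEquivProd, isum_sigma]
  refine congrArg isum (funext fun n => ?_)
  rw [isum_fintype, ← Finset.sum_coe_sort (antidiagonal n) fun x => f x.1 x.2]
  rfl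

end Sums

noncomputable instance : CompleteSemiring ℝ≥0∞ where
  isum f := ∑' i, f i
  isum_fintype f := tsum_fintype f
  isum_sigma f := ENNReal.tsum_sigma' f
  isum_equiv e f := e.tsum_eq f
  mul_isum _ _ := ENNReal.tsum_mul_left.symm

theorem isum_eq_tsum {ι : Type} (f : ι → ℝ≥0∞) : isum f = ∑' i, f i := rfl

/-- The coefficientwise sum of a family of power series. -/
def coeffwiseSum {σ R : Type*} {ι : Type} [CommSemiring R] [CompleteSemiring R]
    (f : ι → MvPowerSeries σ R) : MvPowerSeries σ R :=
  fun s => isum fun i => MvPowerSeries.coeff s (f i)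

theorem coeff_coeffwiseSum {σ R : Type*} {ι : Type} [CommSemiring R] [CompleteSemiring R]
    (f : ι → MvPowerSeries σ R) (s : σ →₀ ℕ) :
    MvPowerSeries.coeff s (coeffwiseSum f) = isum fun i => MvPowerSeries.coeff s (f i) := rfl

noncomputable instance {σ R : Type*} [CommSemiring R] [CompleteSemiring R] :
    CompleteSemiring (MvPowerSeries σ R) where
  isum f := coeffwiseSum f
  isum_fintype f := by
    ext s
    rw [map_sum]
    exact isum_fintype _
  isum_sigma f := by
    ext s
    exact isum_sigma _
  isum_equiv e f := by
    ext s
    exact isum_equiv e fun i => MvPowerSeries.coeff s (f i)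
  mul_isum a f := by
    classical
    ext s
    simp only [MvPowerSeries.coeff_mul, coeff_coeffwiseSum, mul_isum, isum_finset_sum]

noncomputable instance {R : Type*} [CommSemiring R] [CompleteSemiring R] :
    CompleteSemiring (PowerSeries R) :=
  inferInstanceAs (CompleteSemiring (MvPowerSeries Unit R))

theorem mvPowerSeries_coeff_isum {σ R : Type*} {ι : Type} [CommSemiring R] [CompleteSemiring R]
    (s : σ →₀ ℕ) (f : ι → MvPowerSeries σ R) :
    MvPowerSeries.coeff s (isum f) = isum fun i => MvPowerSeries.coeff s (f i) := rfl

theorem powerSeries_coeff_isum {R : Type*} {ι : Type} [CommSemiring R] [CompleteSemiring R]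
    (n : ℕ) (f : ι → PowerSeries R) :
    PowerSeries.coeff n (isum f) = isum fun i => PowerSeries.coeff n (f i) := rfl

section Eval

variable {R R' : Type*} [CommSemiring R] [CommSemiring R'] [CompleteSemiring R']

/-- The value at `y` of a power series, with coefficients mapped through `ρ`. All sums exist in
`R'`, so there is no condition on `y`. -/
noncomputable def eval₂ (ρ : R →+* R') (y : R') : PowerSeries R →+* R' where
  toFun f := isum fun k => ρ (PowerSeries.coeff k f) * y ^ k
  map_zero' := by simp only [map_zero, zero_mul, isum_zero]
  map_add' f g := by simp only [map_add, add_mul, isum_add]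
  map_one' := by
    rw [isum_eq_single 0 _ fun k hk => by simp [PowerSeries.coeff_one, hk]]
    simp
  map_mul' f g := by
    rw [isum_mul_isum, isum_antidiagonal fun i j => ρ (PowerSeries.coeff i f) * y ^ i *
      (ρ (PowerSeries.coeff j g) * y ^ j)]
    refine congrArg isum (funext fun n => ?_)
    rw [PowerSeries.coeff_mul, map_sum, Finset.sum_mul]
    refine Finset.sum_congr rfl fun x hx => ?_
    rw [← mem_antidiagonal.1 hx, map_mul, pow_add, mul_mul_mul_comm]

theorem eval₂_apply (ρ : R →+* R') (y : R') (f : PowerSeries R) :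
    eval₂ ρ y f = isum fun k => ρ (PowerSeries.coeff k f) * y ^ k := rfl

theorem eval₂_C (ρ : R →+* R') (y : R') (a : R) : eval₂ ρ y (PowerSeries.C a) = ρ a := by
  rw [eval₂_apply, isum_eq_single 0 _ fun k hk => by simp [PowerSeries.coeff_C, hk]]
  simp

theorem eval₂_X (ρ : R →+* R') (y : R') : eval₂ ρ y PowerSeries.X = y := by
  rw [eval₂_apply, isum_eq_single 1 _ fun k hk => by simp [PowerSeries.coeff_X, hk]]
  simp

/-- The value at `y` of a power series with coefficients in the same semiring. -/
noncomputable abbrev eval (y : R') : PowerSeries R' →+* R' := eval₂ (RingHom.id R') y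

theorem eval_isum {ι : Type} (y : R') (f : ι → PowerSeries R') :
    eval y (isum f) = isum fun i => eval y (f i) := by
  simp only [eval₂_apply, powerSeries_coeff_isum, RingHom.id_apply, isum_mul]
  exact isum_comm _

theorem eval_eval₂_C (z : R') (Y f : PowerSeries R') :
    eval z (eval₂ PowerSeries.C Y f) = eval (eval z Y) f := by
  rw [eval₂_apply PowerSeries.C Y f, eval_isum, eval₂_apply]
  simp only [map_mul, map_pow, eval₂_C, RingHom.id_apply]

end Eval

end CompleteSemiring

open CompleteSemiring

section Contraction

variable {σ : Type} {R : Type*} [CommSemiring R]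

/-- Two power series agree in all total degrees less than `N`. -/
def AgreeBelow (N : ℕ) (f g : MvPowerSeries σ R) : Prop :=
  ∀ s : σ →₀ ℕ, s.degree < N → MvPowerSeries.coeff s f = MvPowerSeries.coeff s g

namespace AgreeBelow

variable {N : ℕ} {f g f' g' : MvPowerSeries σ R}

theorem refl (f : MvPowerSeries σ R) : AgreeBelow N f f := fun _ _ => rfl

theorem mul (h : AgreeBelow N f g) (h' : AgreeBelow N f' g') :
    AgreeBelow N (f * f') (g * g') := by
  classical
  intro s hs
  rw [MvPowerSeries.coeff_mul, MvPowerSeries.coeff_mul]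
  refine Finset.sum_congr rfl fun x hx => ?_
  have hdegree : x.1.degree + x.2.degree = s.degree := by
    rw [← map_add, mem_antidiagonal.1 hx]
  rw [h _ (by omega), h' _ (by omega)]

theorem X_mul (i : σ) (h : AgreeBelow N f g) : AgreeBelow (N + 1) (X i * f) (X i * g) := by
  classical
  intro s hs
  rw [X, MvPowerSeries.coeff_monomial_mul, MvPowerSeries.coeff_monomial_mul]
  split_ifs with hle
  · have hdegree : (Finsupp.single i 1).degree + (s - Finsupp.single i 1).degree = s.degree := by
      rw [← map_add, add_tsub_cancel_of_le hle]
    rw [Finsupp.degree_single] at hdegree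
    rw [h _ (by omega)]
  · rfl

theorem isum [CompleteSemiring R] {ι : Type} {f g : ι → MvPowerSeries σ R}
    (h : ∀ i, AgreeBelow N (f i) (g i)) :
    AgreeBelow N (CompleteSemiring.isum f) (CompleteSemiring.isum g) := fun s hs => by
  simp only [mvPowerSeries_coeff_isum, h _ s hs]

theorem prod {ι : Type*} (t : Finset ι) {f g : ι → MvPowerSeries σ R}
    (h : ∀ i, AgreeBelow N (f i) (g i)) : AgreeBelow N (∏ i ∈ t, f i) (∏ i ∈ t, g i) :=
  Finset.prod_hom_rel (refl 1) fun i _ _ hprod => (h i).mul hprod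

end AgreeBelow

theorem eq_of_contracting {ι : Type*} {T : (ι → MvPowerSeries σ R) → ι → MvPowerSeries σ R}
    (hT : ∀ N f g, (∀ i, AgreeBelow N (f i) (g i)) → ∀ i, AgreeBelow (N + 1) (T f i) (T g i))
    {f g : ι → MvPowerSeries σ R} (hf : T f = f) (hg : T g = g) : f = g := by
  have agree (N : ℕ) : ∀ i, AgreeBelow N (f i) (g i) := by
    induction N with
    | zero => exact fun i s hs => absurd hs (Nat.not_lt_zero _)
    | succ N ih => simpa only [hf, hg] using hT N f g ih
  funext i
  ext s
  exact agree (s.degree + 1) i s (Nat.lt_succ_self _)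

end Contraction

section Lagrange

/-- The factor `c / n`, with `n = c + i`, of the Lagrange inversion formula. For `c = n = 0` its
value is `1`. -/
noncomputable def lagrangeFactor (c i : ℕ) : ℝ≥0 := if c + i = 0 then 1 else c / (c + i : ℕ)

theorem sum_mul_coeff_mul_coeff_pow {R : Type*} [CommSemiring R] (φ : PowerSeries R) (n N : ℕ) :
    (n + 1) * ∑ x ∈ antidiagonal N,
        x.1 * (PowerSeries.coeff x.1 φ * PowerSeries.coeff x.2 (φ ^ n)) =
      N * PowerSeries.coeff N (φ ^ (n + 1)) := by
  cases N with
  | zero => simp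
  | succ M =>
    have hderiv := PowerSeries.coeff_derivative (φ ^ (n + 1)) M
    rw [PowerSeries.derivative_pow, Nat.add_sub_cancel, mul_assoc, mul_comm (φ ^ n),
      ← map_natCast (PowerSeries.C (R := R)), PowerSeries.coeff_C_mul, PowerSeries.coeff_mul,
      Nat.cast_succ] at hderiv
    rw [Finset.Nat.antidiagonal_succ, Finset.sum_cons, Finset.sum_map, Nat.cast_zero, zero_mul,
      zero_add, Nat.cast_succ, mul_comm ((M : R) + 1), ← hderiv]
    refine congrArg _ (Finset.sum_congr rfl fun x _ => ?_)
    simp only [PowerSeries.coeff_derivative, Function.Embedding.prodMap,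
      Function.Embedding.coeFn_mk, Prod.map_fst, Prod.map_snd, Function.Embedding.refl_apply,
      Nat.cast_succ]
    ring

theorem sum_add_mul_coeff_mul_coeff_pow {R : Type*} [CommSemiring R] (φ : PowerSeries R)
    (c N : ℕ) :
    (c + N + 1) * ∑ x ∈ antidiagonal N,
        (x.1 + c) * (PowerSeries.coeff x.1 φ * PowerSeries.coeff x.2 (φ ^ (c + N))) =
      (c + 1) * (c + N) * PowerSeries.coeff N (φ ^ (c + N + 1)) := by
  have hsum : ∑ x ∈ antidiagonal N, PowerSeries.coeff x.1 φ * PowerSeries.coeff x.2 (φ ^ (c + N)) =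
      PowerSeries.coeff N (φ ^ (c + N + 1)) := by
    rw [pow_succ', PowerSeries.coeff_mul]
  have hderiv := sum_mul_coeff_mul_coeff_pow φ (c + N) N
  simp only [add_mul _ (c : R), Finset.sum_add_distrib, ← Finset.mul_sum, hsum]
  push_cast at hderiv
  rw [mul_add, hderiv]
  ring

theorem sum_lagrangeFactor_smul {R : Type*} [CommSemiring R] [Algebra ℝ≥0 R] (φ : PowerSeries R)
    (c N : ℕ) :
    ∑ x ∈ antidiagonal N, lagrangeFactor (x.1 + c) x.2 •
        (PowerSeries.coeff x.1 φ * PowerSeries.coeff x.2 (φ ^ (c + N))) =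
      lagrangeFactor (c + 1) N • PowerSeries.coeff N (φ ^ (c + N + 1)) := by
  rcases Nat.eq_zero_or_pos (c + N) with hzero | hpos
  · obtain ⟨rfl, rfl⟩ : c = 0 ∧ N = 0 := by omega
    simp [lagrangeFactor]
  have hne : (c + N : ℝ≥0) ≠ 0 := by exact_mod_cast hpos.ne'
  have hfactor : ∀ x ∈ antidiagonal N,
      lagrangeFactor (x.1 + c) x.2 = (c + N : ℝ≥0)⁻¹ * (x.1 + c) := fun x hx => by
    have hx : x.1 + c + x.2 = c + N := by rw [← mem_antidiagonal.1 hx]; ring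
    rw [lagrangeFactor, hx, if_neg hpos.ne', div_eq_inv_mul]
    push_cast
    rfl
  have hfactor' : lagrangeFactor (c + 1) N =
      ((c + N : ℝ≥0)⁻¹ * (c + N + 1 : ℝ≥0)⁻¹) * ((c + 1) * (c + N)) := by
    rw [lagrangeFactor, if_neg (by omega)]
    push_cast
    field_simp
    ring
  have hcleared : (c + N + 1 : ℝ≥0) • ∑ x ∈ antidiagonal N, (x.1 + c : ℝ≥0) •
      (PowerSeries.coeff x.1 φ * PowerSeries.coeff x.2 (φ ^ (c + N))) =
      ((c + 1) * (c + N) : ℝ≥0) • PowerSeries.coeff N (φ ^ (c + N + 1)) := by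
    simpa [Algebra.smul_def] using sum_add_mul_coeff_mul_coeff_pow φ c N
  calc _ = (c + N : ℝ≥0)⁻¹ • ∑ x ∈ antidiagonal N, (x.1 + c : ℝ≥0) •
          (PowerSeries.coeff x.1 φ * PowerSeries.coeff x.2 (φ ^ (c + N))) := by
        rw [Finset.smul_sum]
        exact Finset.sum_congr rfl fun x hx => by rw [hfactor x hx, mul_smul]
    _ = _ := by
        rw [hfactor', mul_smul, ← hcleared, ← mul_smul, mul_assoc,
          inv_mul_cancel₀ (by positivity), mul_one]

section Inversion

variable {σ : Type} {R : Type*} [CommSemiring R] [CompleteSemiring R] [Algebra ℝ≥0 R] {p : σ}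

/-- The expression given by the Lagrange inversion formula for the `c`-th power of the solution `V`
of `V = X p * φ(V)`. -/
noncomputable def lagrangeSeries (p : σ) (φ : PowerSeries (MvPowerSeries σ R)) (c : ℕ) :
    MvPowerSeries σ R :=
  isum fun i : ℕ => lagrangeFactor c i • (X p ^ (c + i) * PowerSeries.coeff i (φ ^ (c + i)))

theorem lagrangeSeries_zero (p : σ) (φ : PowerSeries (MvPowerSeries σ R)) :
    lagrangeSeries p φ 0 = 1 := by
  rw [lagrangeSeries, isum_eq_single 0 _ fun i hi => by simp [lagrangeFactor, hi]]
  simp [lagrangeFactor]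

theorem lagrangeSeries_succ (p : σ) (φ : PowerSeries (MvPowerSeries σ R)) (c : ℕ) :
    lagrangeSeries p φ (c + 1) =
      X p * isum fun k => PowerSeries.coeff k φ * lagrangeSeries p φ (k + c) := by
  simp only [lagrangeSeries, mul_isum]
  rw [isum_antidiagonal fun k i => X p * (PowerSeries.coeff k φ * (lagrangeFactor (k + c) i •
    (X p ^ (k + c + i) * PowerSeries.coeff i (φ ^ (k + c + i)))))]
  refine congrArg isum (funext fun N => ?_)
  rw [add_right_comm c 1 N, ← mul_smul_comm, ← sum_lagrangeFactor_smul, Finset.mul_sum]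
  refine Finset.sum_congr rfl fun x hx => ?_
  rw [show x.1 + c + x.2 = c + N by rw [← mem_antidiagonal.1 hx]; ring]
  simp only [Algebra.smul_def]
  ring

theorem pow_eq_lagrangeSeries {φ : PowerSeries (MvPowerSeries σ R)} {V : MvPowerSeries σ R}
    (hV : V = X p * eval V φ) (c : ℕ) : V ^ c = lagrangeSeries p φ c := by
  -- The recursion of `lagrangeSeries_succ` is contracting and is satisfied by the powers of `V`.
  let T (A : ℕ → MvPowerSeries σ R) : ℕ → MvPowerSeries σ R
    | 0 => 1
    | c + 1 => X p * isum fun k => PowerSeries.coeff k φ * A (k + c)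
  have hT (N : ℕ) (A B : ℕ → MvPowerSeries σ R) (h : ∀ c, AgreeBelow N (A c) (B c)) :
      ∀ c, AgreeBelow (N + 1) (T A c) (T B c)
    | 0 => .refl _
    | c + 1 => .X_mul p (.isum fun k => (AgreeBelow.refl _).mul (h _))
  have hpow : (T fun c => V ^ c) = fun c => V ^ c := funext fun
    | 0 => (pow_zero V).symm
    | c + 1 => by
      have hsum : (isum fun k => PowerSeries.coeff k φ * V ^ (k + c)) = eval V φ * V ^ c := by
        simp only [eval₂_apply, RingHom.id_apply, isum_mul, pow_add, mul_assoc]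
      rw [pow_succ', show T (fun c => V ^ c) (c + 1) = X p * _ from rfl, hsum, ← mul_assoc, ← hV]
  have hseries : T (lagrangeSeries p φ) = lagrangeSeries p φ := funext fun
    | 0 => (lagrangeSeries_zero p φ).symm
    | c + 1 => (lagrangeSeries_succ p φ c).symm
  exact congrFun (eq_of_contracting hT hpow hseries) c

theorem eval_eq_isum_of_eq_X_mul_eval {q V : MvPowerSeries σ R}
    {L U : PowerSeries (MvPowerSeries σ R)}
    (hV : V = X p * eval (q * eval V L) U) (H : PowerSeries (MvPowerSeries σ R)) :
    eval V H = isum fun y : ℕ × ℕ =>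
      (∑ x ∈ antidiagonal y.1, lagrangeFactor x.1 x.2 •
        (PowerSeries.coeff x.1 H * PowerSeries.coeff x.2 (L ^ y.2))) *
      (PowerSeries.coeff y.2 (U ^ y.1) * (X p ^ y.1 * q ^ y.2)) := by
  set φ := eval₂ PowerSeries.C (PowerSeries.C q * L) U with hφ
  have hVφ : V = X p * eval V φ := by
    rwa [hφ, eval_eval₂_C, map_mul, eval₂_C, RingHom.id_apply]
  have coeff_φ_pow (i n : ℕ) : PowerSeries.coeff i (φ ^ n) = isum fun d =>
      PowerSeries.coeff d (U ^ n) * (q ^ d * PowerSeries.coeff i (L ^ d)) := by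
    rw [hφ, ← map_pow, eval₂_apply, powerSeries_coeff_isum]
    simp only [mul_pow, ← map_pow, PowerSeries.coeff_C_mul]
  rw [eval₂_apply, isum_prod]
  simp only [RingHom.id_apply, pow_eq_lagrangeSeries hVφ, lagrangeSeries, mul_isum]
  rw [isum_antidiagonal fun c i => PowerSeries.coeff c H *
    (lagrangeFactor c i • (X p ^ (c + i) * PowerSeries.coeff i (φ ^ (c + i))))]
  refine congrArg isum (funext fun n => ?_)
  simp only [Finset.sum_mul, isum_finset_sum]
  refine Finset.sum_congr rfl fun x hx => ?_
  simp only [mem_antidiagonal.1 hx, coeff_φ_pow, mul_isum, Algebra.smul_def]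
  exact congrArg isum (funext fun d => by ring)

end Inversion

end Lagrange

section Support

variable {σ : Type} {R : Type*} [CommSemiring R]

/-- The power series all of whose monomials have their exponents in a given monoid. -/
def supportedOn (M : AddSubmonoid (σ →₀ ℕ)) : Subsemiring (MvPowerSeries σ R) where
  carrier := {f | ∀ s, MvPowerSeries.coeff s f ≠ 0 → s ∈ M}
  mul_mem' {f g} hf hg s hs := by
    classical
    rw [MvPowerSeries.coeff_mul] at hs
    obtain ⟨x, hx, hne⟩ := Finset.exists_ne_zero_of_sum_ne_zero hs
    rw [← mem_antidiagonal.1 hx]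
    exact M.add_mem (hf _ (left_ne_zero_of_mul hne)) (hg _ (right_ne_zero_of_mul hne))
  one_mem' s hs := by
    classical
    rw [MvPowerSeries.coeff_one, ite_ne_right_iff] at hs
    exact hs.1 ▸ M.zero_mem
  add_mem' {f g} hf hg s hs := by
    by_cases hzero : MvPowerSeries.coeff s f = 0
    · exact hg s (by rwa [map_add, hzero, zero_add] at hs)
    · exact hf s hzero
  zero_mem' s hs := absurd (map_zero _) hs

theorem monomial_mem_supportedOn {M : AddSubmonoid (σ →₀ ℕ)} {s : σ →₀ ℕ} (hs : s ∈ M) (a : R) :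
    MvPowerSeries.monomial s a ∈ supportedOn M := by
  classical
  intro t ht
  rw [MvPowerSeries.coeff_monomial, ite_ne_right_iff] at ht
  exact ht.1 ▸ hs

theorem smul_mem_supportedOn {A : Type*} [CommSemiring A] [Algebra A R]
    {M : AddSubmonoid (σ →₀ ℕ)} (a : A) {f : MvPowerSeries σ R} (hf : f ∈ supportedOn M) :
    a • f ∈ supportedOn M := by
  rw [Algebra.smul_def, MvPowerSeries.algebraMap_apply]
  exact mul_mem (monomial_mem_supportedOn M.zero_mem _) hf

theorem isum_mem_supportedOn [CompleteSemiring R] {M : AddSubmonoid (σ →₀ ℕ)} {ι : Type}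
    {f : ι → MvPowerSeries σ R} (hf : ∀ i, f i ∈ supportedOn M) : isum f ∈ supportedOn M := by
  intro s hs
  by_contra hsM
  refine hs ?_
  have hzero (i : ι) : MvPowerSeries.coeff s (f i) = 0 := of_not_not fun h => hsM (hf i s h)
  simp only [mvPowerSeries_coeff_isum, hzero, isum_zero]

/-- The power series in one variable with all coefficients in a given subsemiring. -/
def coeffsIn (Q : Subsemiring R) : Subsemiring (PowerSeries R) where
  carrier := {f | ∀ n, PowerSeries.coeff n f ∈ Q}
  mul_mem' {f g} hf hg n := by
    rw [PowerSeries.coeff_mul]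
    exact sum_mem fun x _ => mul_mem (hf _) (hg _)
  one_mem' n := by
    rw [PowerSeries.coeff_one]
    split_ifs
    exacts [one_mem Q, zero_mem Q]
  add_mem' {f g} hf hg n := by
    rw [map_add]
    exact add_mem (hf n) (hg n)
  zero_mem' n := by
    rw [map_zero]
    exact zero_mem Q

theorem C_mem_coeffsIn {Q : Subsemiring R} {a : R} (ha : a ∈ Q) : PowerSeries.C a ∈ coeffsIn Q := by
  intro n
  rw [PowerSeries.coeff_C]
  split_ifs
  exacts [ha, zero_mem Q]

theorem X_mem_coeffsIn (Q : Subsemiring R) : PowerSeries.X ∈ coeffsIn Q := by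
  intro n
  rw [PowerSeries.coeff_X]
  split_ifs
  exacts [one_mem Q, zero_mem Q]

theorem isum_mem_coeffsIn [CompleteSemiring R] {Q : Subsemiring R} {ι : Type}
    (hQ : ∀ f : ι → R, (∀ i, f i ∈ Q) → isum f ∈ Q) {f : ι → PowerSeries R}
    (hf : ∀ i, f i ∈ coeffsIn Q) : isum f ∈ coeffsIn Q := by
  intro n
  rw [powerSeries_coeff_isum]
  exact hQ _ fun i => hf i n

end Support

section CoeffMass

variable {σ : Type}

/-- The sum of the coefficients of a power series over the exponents in a set. -/
noncomputable def coeffMass (f : MvPowerSeries σ ℝ≥0∞) (E : Set (σ →₀ ℕ)) : ℝ≥0∞ :=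
  ∑' s, E.indicator (fun s => MvPowerSeries.coeff s f) s

theorem coeffMass_isum {ι : Type} (f : ι → MvPowerSeries σ ℝ≥0∞) (E : Set (σ →₀ ℕ)) :
    coeffMass (isum f) E = ∑' i, coeffMass (f i) E := by
  simp only [coeffMass]
  rw [ENNReal.tsum_comm]
  refine tsum_congr fun s => ?_
  by_cases hs : s ∈ E
  · simp only [Set.indicator_of_mem hs, mvPowerSeries_coeff_isum, isum_eq_tsum]
  · simp only [Set.indicator_of_notMem hs, tsum_zero]

theorem coeffMass_monomial (s : σ →₀ ℕ) (a : ℝ≥0∞) (E : Set (σ →₀ ℕ)) :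
    coeffMass (MvPowerSeries.monomial s a) E = E.indicator (fun _ => a) s := by
  classical
  rw [coeffMass, tsum_eq_single s fun t ht => by
    simp [Set.indicator_apply, MvPowerSeries.coeff_monomial, ht]]
  simp [Set.indicator_apply]

theorem coeffMass_mul {f g : MvPowerSeries σ ℝ≥0∞} {E A B : Set (σ →₀ ℕ)}
    (hE : ∀ a b, MvPowerSeries.coeff a f ≠ 0 → MvPowerSeries.coeff b g ≠ 0 →
      (a + b ∈ E ↔ a ∈ A ∧ b ∈ B)) :
    coeffMass (f * g) E = coeffMass f A * coeffMass g B := by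
  classical
  have split (a b : σ →₀ ℕ) :
      E.indicator 1 (a + b) * (MvPowerSeries.coeff a f * MvPowerSeries.coeff b g) =
        A.indicator (fun a => MvPowerSeries.coeff a f) a *
          B.indicator (fun b => MvPowerSeries.coeff b g) b := by
    by_cases ha : MvPowerSeries.coeff a f = 0
    · simp [Set.indicator_apply, ha]
    by_cases hb : MvPowerSeries.coeff b g = 0
    · simp [Set.indicator_apply, hb]
    have := hE a b ha hb
    by_cases a ∈ A <;> by_cases b ∈ B <;> simp_all
  have coeff_mul (s : σ →₀ ℕ) : E.indicator (fun s => MvPowerSeries.coeff s (f * g)) s =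
      ∑ x ∈ antidiagonal s,
        E.indicator 1 (x.1 + x.2) * (MvPowerSeries.coeff x.1 f * MvPowerSeries.coeff x.2 g) := by
    rw [Finset.sum_congr rfl fun x hx => by rw [mem_antidiagonal.1 hx], ← Finset.mul_sum,
      ← MvPowerSeries.coeff_mul]
    simp [Set.indicator_apply]
  have rearrange := isum_antidiagonal fun a b : σ →₀ ℕ =>
    E.indicator 1 (a + b) * (MvPowerSeries.coeff a f * MvPowerSeries.coeff b g)
  simp only [coeffMass, coeff_mul]
  rw [← isum_eq_tsum, ← rearrange]
  simp only [split, isum_eq_tsum, ENNReal.tsum_mul_left, ENNReal.tsum_mul_right]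

theorem coeffMass_mul_monomial (f : MvPowerSeries σ ℝ≥0∞) (t : σ →₀ ℕ) (E : Set (σ →₀ ℕ)) :
    coeffMass (f * MvPowerSeries.monomial t 1) E = coeffMass f {s | s + t ∈ E} := by
  classical
  rw [coeffMass_mul (A := {s | s + t ∈ E}) (B := Set.univ), coeffMass_monomial,
    Set.indicator_of_mem (Set.mem_univ t), mul_one]
  intro a b _ hb
  rw [MvPowerSeries.coeff_monomial, ite_ne_right_iff] at hb
  rw [hb.1, and_iff_left (Set.mem_univ t)]
  rfl

end CoeffMass

section Probability

theorem exists_pmf_mul_eq {S : Type*} [Nonempty S] (q : S → ℝ≥0∞) :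
    ∃ p : PMF S, ∀ a, a * ∑' z, q z ≠ ∞ → ∀ z, a * q z = a * (∑' z, q z) * p z := by
  by_cases hzero : ∑' z, q z = 0
  · refine ⟨PMF.pure (Classical.arbitrary S), fun a _ z => ?_⟩
    rw [hzero, ENNReal.tsum_eq_zero.1 hzero z, mul_zero, zero_mul]
  by_cases htop : ∑' z, q z = ∞
  · refine ⟨PMF.pure (Classical.arbitrary S), fun a ha z => ?_⟩
    obtain rfl : a = 0 := of_not_not fun ha0 => ha (by rw [htop, ENNReal.mul_top ha0])
    simp only [zero_mul]
  · refine ⟨PMF.normalize q hzero htop, fun a _ z => ?_⟩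
    rw [PMF.normalize_apply, mul_assoc, mul_left_comm (∑' z, q z),
      ENNReal.mul_inv_cancel hzero htop, mul_one]

variable {Ω : Type*} [MeasurableSpace Ω] {μ : Measure Ω} [IsFiniteMeasure μ]

theorem isTimeHomogeneousMarkovChain_of_measure_eq_mul {S : Type*} [Countable S] [Nonempty S]
    {Y : Ω → ℕ → S} (hY : ∀ n z, MeasurableSet {ω | Y ω n = z}) {q : S → S → ℝ≥0∞}
    (h : ∀ (n : ℕ) (y : ℕ → S), ∃ a, ∀ z,
      μ {ω | (∀ i ≤ n, Y ω i = y i) ∧ Y ω (n + 1) = z} = a * q (y n) z) :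
    IsTimeHomogeneousMarkovChain μ Y := by
  choose K hK using fun x => exists_pmf_mul_eq (q x)
  refine ⟨K, fun n y => ?_⟩
  obtain ⟨a, ha⟩ := h n y
  have past : μ {ω | ∀ i ≤ n, Y ω i = y i} = a * ∑' z, q (y n) z := by
    rw [← ENNReal.tsum_mul_left, ← tsum_congr ha, ← measure_iUnion]
    · congr 1
      ext ω
      simp
    · exact fun z z' hz => Set.disjoint_left.2 fun ω hω hω' => hz (hω.2.symm.trans hω'.2)
    · intro z
      simp only [Set.ofPred_and, Set.ofPred_forall]
      exact .inter (.iInter fun i => .iInter fun _ => hY i _) (hY _ z)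
  have future : {ω | ∀ i ≤ n + 1, Y ω i = y i} =
      {ω | (∀ i ≤ n, Y ω i = y i) ∧ Y ω (n + 1) = y (n + 1)} := by
    ext ω
    simp only [Set.mem_ofPred_eq, Nat.le_succ_iff, or_imp, forall_and, forall_eq]
  rw [future, ha, past]
  exact hK (y n) _ (past ▸ measure_ne_top μ _) _

theorem indepFun_cond_of_measure_inter_eq_mul {α β : Type*} [MeasurableSpace α]
    [MeasurableSpace β] {E : Set Ω} (hE : MeasurableSet E) {f : Ω → α} {g : Ω → β}
    {a : Set α → ℝ≥0∞} {b : Set β → ℝ≥0∞}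
    (h : ∀ A B, MeasurableSet A → MeasurableSet B →
      μ (E ∩ (f ⁻¹' A ∩ g ⁻¹' B)) = a A * b B) :
    IndepFun f g (cond μ E) := by
  rw [indepFun_iff_measure_inter_preimage_eq_mul]
  intro A B hA hB
  by_cases hzero : μ E = 0
  · simp only [cond_eq_zero_of_meas_eq_zero hzero, Measure.coe_zero, Pi.zero_apply, mul_zero]
  have hEab : μ E = a Set.univ * b Set.univ := by simpa using h _ _ .univ .univ
  have hf : μ (E ∩ f ⁻¹' A) = a A * b Set.univ := by simpa using h _ _ hA .univ
  have hg : μ (E ∩ g ⁻¹' B) = a Set.univ * b B := by simpa using h _ _ .univ hB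
  simp only [cond_apply hE, h A B hA hB, hf, hg]
  calc (μ E)⁻¹ * (a A * b B) = (μ E)⁻¹ * (a A * b B) * ((μ E)⁻¹ * μ E) := by
        rw [ENNReal.inv_mul_cancel hzero (measure_ne_top μ E), mul_one]
    _ = (μ E)⁻¹ * (a A * b B) * ((μ E)⁻¹ * (a Set.univ * b Set.univ)) := by rw [← hEab]
    _ = (μ E)⁻¹ * (a A * b Set.univ) * ((μ E)⁻¹ * (a Set.univ * b B)) := by ring

end Probability

section FixedPoint

/-- Bernoulli's inequality with `k + 1` replaced by the smaller factor `k * Q + 1`, which makes the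
usual form strict. -/
theorem one_le_pow_succ_add_mul_one_sub {Q : ℝ≥0∞} (hQ : Q ≤ 1) (k : ℕ) :
    1 ≤ Q ^ (k + 1) + (k * Q + 1) * (1 - Q) := by
  induction k with
  | zero => simp [add_tsub_cancel_of_le hQ]
  | succ k ih =>
    calc 1 = Q + (1 - Q) := (add_tsub_cancel_of_le hQ).symm
      _ ≤ Q * (Q ^ (k + 1) + (k * Q + 1) * (1 - Q)) + (1 - Q) := by
        gcongr
        exact le_mul_of_one_le_right' ih
      _ = Q ^ (k + 1 + 1) + ((Q * k + 1) * Q + 1) * (1 - Q) := by ring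
      _ ≤ Q ^ (k + 1 + 1) + ((1 * k + 1) * Q + 1) * (1 - Q) := by gcongr
      _ = Q ^ (k + 1 + 1) + ((k + 1 : ℕ) * Q + 1) * (1 - Q) := by push_cast; ring

theorem one_lt_pow_add_mul_one_sub {Q : ℝ≥0∞} (hQ : Q < 1) {k : ℕ} (hk : 2 ≤ k) :
    1 < Q ^ k + k * (1 - Q) := by
  obtain ⟨k, rfl⟩ := Nat.exists_eq_add_of_le' hk
  have hsub : 1 - Q ≠ 0 := (tsub_pos_of_lt hQ).ne'
  have hlt : ((k + 1 : ℕ) : ℝ≥0∞) * Q < (k + 1 : ℕ) * 1 :=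
    ENNReal.mul_lt_mul_right (by simp) (ENNReal.natCast_ne_top _) hQ
  calc 1 ≤ Q ^ (k + 2) + ((k + 1 : ℕ) * Q + 1) * (1 - Q) :=
        one_le_pow_succ_add_mul_one_sub hQ.le (k + 1)
    _ < Q ^ (k + 2) + ((k + 1 : ℕ) * 1 + 1) * (1 - Q) := by
        refine ENNReal.add_lt_add_left (ENNReal.pow_ne_top hQ.ne_top) ?_
        exact ENNReal.mul_lt_mul_left hsub (by simp) (ENNReal.add_lt_add_right (by simp) hlt)
    _ = Q ^ (k + 2) + (k + 2 : ℕ) * (1 - Q) := by push_cast; ring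

theorem apply_eq_zero_of_tsum_mul_pow_eq {ξ : PMF ℕ} (hmean : ∑' k : ℕ, ξ k * (k : ℝ≥0∞) ≤ 1)
    {Q : ℝ≥0∞} (hQ : Q < 1) (hfix : ∑' k, ξ k * Q ^ k = Q) {k : ℕ} (hk : 2 ≤ k) : ξ k = 0 := by
  have hsum : Q + (1 - Q) = 1 := add_tsub_cancel_of_le hQ.le
  have bernoulli (k : ℕ) : 1 ≤ Q ^ k + k * (1 - Q) := by
    match k with
    | 0 => simp
    | 1 => simp [hsum]
    | k + 2 => exact (one_lt_pow_add_mul_one_sub hQ (Nat.le_add_left 2 k)).le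
  have upper : ∑' k, ξ k * (Q ^ k + k * (1 - Q)) ≤ 1 :=
    calc ∑' k, ξ k * (Q ^ k + k * (1 - Q)) = Q + (∑' k, ξ k * k) * (1 - Q) := by
          simp only [mul_add, ← mul_assoc, ENNReal.tsum_add, ENNReal.tsum_mul_right, hfix]
      _ ≤ Q + 1 * (1 - Q) := by gcongr
      _ = 1 := by rw [one_mul, hsum]
  by_contra hξk
  refine (ξ.tsum_coe.symm.trans_lt <| ENNReal.tsum_lt_tsum ξ.tsum_coe_ne_top
    (fun k => le_mul_of_one_le_right' (bernoulli k)) (i := k) ?_).not_ge upper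
  calc ξ k = ξ k * 1 := (mul_one _).symm
    _ < ξ k * (Q ^ k + k * (1 - Q)) :=
      ENNReal.mul_lt_mul_right hξk (ξ.apply_ne_top k) (one_lt_pow_add_mul_one_sub hQ hk)

theorem eq_one_of_tsum_mul_pow_eq {ξ : PMF ℕ} (hmean : ∑' k : ℕ, ξ k * (k : ℝ≥0∞) ≤ 1)
    (hξ : ξ 1 ≠ 1) {Q : ℝ≥0∞} (hQ : Q ≤ 1) (hfix : ∑' k, ξ k * Q ^ k = Q) : Q = 1 := by
  by_contra hne
  replace hQ : Q < 1 := lt_of_le_of_ne hQ hne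
  have hsum : Q + (1 - Q) = 1 := add_tsub_cancel_of_le hQ.le
  have small (k : ℕ) (hk : k ∉ Finset.range 2) : ξ k = 0 :=
    apply_eq_zero_of_tsum_mul_pow_eq hmean hQ hfix (not_lt.1 (Finset.mem_range.not.1 hk))
  have tsum_mul (f : ℕ → ℝ≥0∞) : ∑' k, ξ k * f k = ξ 0 * f 0 + ξ 1 * f 1 := by
    rw [tsum_eq_sum (s := Finset.range 2) fun k hk => by rw [small k hk, zero_mul],
      Finset.sum_range_succ, Finset.sum_range_one]
  have mass : ξ 0 + ξ 1 = 1 := by simpa [ξ.tsum_coe, eq_comm] using tsum_mul 1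
  have fixed : ξ 0 + ξ 1 * Q = Q := by simpa [hfix, eq_comm] using tsum_mul (Q ^ ·)
  have cancel : ξ 1 * (1 - Q) = 1 * (1 - Q) := by
    refine (ENNReal.add_right_inj hQ.ne_top).1 ?_
    calc Q + ξ 1 * (1 - Q) = ξ 0 + ξ 1 * (Q + (1 - Q)) := by rw [mul_add, ← add_assoc, fixed]
      _ = Q + 1 * (1 - Q) := by rw [hsum, mul_one, mass, one_mul, hsum]
  exact hξ ((ENNReal.mul_left_inj (tsub_pos_of_lt hQ).ne' (by simp)).1 cancel)

end FixedPoint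

namespace LabelledPlaneTree

/-- The degree of a vertex together with the increments towards its children. -/
abbrev Offspring : Type := Σ k : ℕ, Fin k → SignType

/-- A tree is the offspring of its root together with the family of subtrees. -/
def nodeEquiv : (Σ a : Offspring, Fin a.1 → LabelledPlaneTree) ≃ LabelledPlaneTree where
  toFun x := node x.1.1 x.1.2 x.2
  invFun := fun | node k δ c => ⟨⟨k, δ⟩, c⟩
  left_inv _ := rfl
  right_inv := fun | node _ _ _ => rfl

section PartitionFunction

variable {R : Type*} [CommSemiring R]

theorem isum_tree [CompleteSemiring R] {F : LabelledPlaneTree → R} {K : Offspring → R}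
    {G : ∀ a : Offspring, Fin a.1 → LabelledPlaneTree → R}
    (hF : ∀ k δ c, F (node k δ c) = K ⟨k, δ⟩ * ∏ i, G ⟨k, δ⟩ i (c i)) :
    isum F = isum fun a => K a * ∏ i, isum (G a i) := by
  rw [← isum_equiv nodeEquiv, isum_sigma]
  refine congrArg isum (funext fun a => ?_)
  rw [prod_isum, mul_isum]
  exact congrArg isum (funext fun c => hF _ _ _)

/-- The weight of a tree whose root has label `x`, when a vertex with label `y` and offspring `a`
has weight `K y a`. -/
def treeWeight (K : ℤ → Offspring → R) : ℤ → LabelledPlaneTree → R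
  | x, node k δ c => K x ⟨k, δ⟩ * ∏ i, treeWeight K (x + (δ i : ℤ)) (c i)

variable [CompleteSemiring R]

/-- The total weight of the trees whose root has label `x`. -/
noncomputable def partitionFunction (K : ℤ → Offspring → R) (x : ℤ) : R := isum (treeWeight K x)

theorem partitionFunction_eq (K : ℤ → Offspring → R) (x : ℤ) :
    partitionFunction K x =
      isum fun a : Offspring => K x a * ∏ i, partitionFunction K (x + (a.2 i : ℤ)) :=
  isum_tree fun _ _ _ => by rw [treeWeight]

theorem partitionFunction_mem {Q : Subsemiring R}
    (hQ : ∀ f : LabelledPlaneTree → R, (∀ t, f t ∈ Q) → isum f ∈ Q) {K : ℤ → Offspring → R}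
    (hK : ∀ x a, K x a ∈ Q) (x : ℤ) : partitionFunction K x ∈ Q := by
  refine hQ _ fun t => ?_
  induction t generalizing x with
  | node k δ c ih =>
    rw [treeWeight]
    exact mul_mem (hK _ _) (prod_mem fun i _ => ih i _)

end PartitionFunction

/-- Power series with one variable for every type of edge, an edge type being given by the label of
the parent and the increment. -/
abbrev EdgeSeries : Type := MvPowerSeries (ℤ × SignType) ℝ≥0∞

section Cutting

open MvPowerSeries (C)

/-- The weight of a vertex with label `x` in a tree, counting the edges that lead from it to its
children. -/
noncomputable def edgeWeight (w : Offspring → ℝ≥0∞) (x : ℤ) (a : Offspring) : EdgeSeries :=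
  C (w a) * ∏ i, X (x, a.2 i)

/-- The generating function of the trees by their edges, when the root has label `x`. -/
noncomputable def edgeGf (w : Offspring → ℝ≥0∞) (x : ℤ) : EdgeSeries :=
  partitionFunction (edgeWeight w) x

variable (w : Offspring → ℝ≥0∞)

theorem edgeGf_eq (x : ℤ) : edgeGf w x = isum fun a : Offspring =>
    C (w a) * ∏ i, (X (x, a.2 i) * edgeGf w (x + (a.2 i : ℤ))) := by
  rw [edgeGf, partitionFunction_eq]
  simp only [edgeWeight, mul_assoc, ← Finset.prod_mul_distrib]
  rfl

open scoped Classical in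
/-- The weight of a vertex with label `x` in a piece, that is, in a tree cut at the first edges that
lead out of `D`. The edges inside `D` are counted by their own variables and the cut edges by the
variable of the power series; the vertices outside `D` are leaves of weight `1`. -/
noncomputable def pieceWeight (D : Set ℤ) (x : ℤ) (a : Offspring) : PowerSeries EdgeSeries :=
  if x ∈ D then
    PowerSeries.C (C (w a)) * ∏ i,
      if x + (a.2 i : ℤ) ∈ D then PowerSeries.C (X (x, a.2 i)) else PowerSeries.X
  else if a.1 = 0 then 1 else 0

/-- The generating function of the pieces of trees cut at the first edges that lead out of `D`. -/
noncomputable def pieceSeries (D : Set ℤ) (x : ℤ) : PowerSeries EdgeSeries :=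
  partitionFunction (pieceWeight w D) x

theorem pieceSeries_of_notMem {D : Set ℤ} {x : ℤ} (hx : x ∉ D) : pieceSeries w D x = 1 := by
  rw [pieceSeries, partitionFunction_eq, isum_eq_single ⟨0, Fin.elim0⟩]
  · simp [pieceWeight, hx]
  · rintro ⟨k, δ⟩ hne
    have hk : k ≠ 0 := by
      rintro rfl
      exact hne (congrArg _ (Subsingleton.elim _ _))
    simp [pieceWeight, hx, hk]

open scoped Classical in
theorem eval_pieceSeries {D : Set ℤ} {x : ℤ} (hx : x ∈ D) (Y : EdgeSeries) :
    eval Y (pieceSeries w D x) = isum fun a : Offspring => C (w a) * ∏ i,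
      if x + (a.2 i : ℤ) ∈ D then X (x, a.2 i) * eval Y (pieceSeries w D (x + (a.2 i : ℤ)))
      else Y := by
  rw [pieceSeries, partitionFunction_eq, eval_isum]
  refine congrArg isum (funext fun a => ?_)
  rw [pieceWeight, if_pos hx, mul_assoc, ← Finset.prod_mul_distrib, map_mul, map_prod, eval₂_C]
  refine congrArg _ (Finset.prod_congr rfl fun i _ => ?_)
  rw [map_mul]
  split_ifs with hi
  · rw [eval₂_C]
    rfl
  · rw [eval₂_X, ← pieceSeries, pieceSeries_of_notMem w hi, map_one, mul_one]

theorem edgeGf_eq_eval_pieceSeries {D : Set ℤ} {Y : EdgeSeries}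
    (hY : ∀ x ∈ D, ∀ ε : SignType, x + (ε : ℤ) ∉ D → X (x, ε) * edgeGf w (x + (ε : ℤ)) = Y)
    {x : ℤ} (hx : x ∈ D) : edgeGf w x = eval Y (pieceSeries w D x) := by
  classical
  let T (A : ℤ → EdgeSeries) (x : ℤ) : EdgeSeries :=
    if x ∈ D then isum fun a : Offspring => C (w a) * ∏ i, (X (x, a.2 i) * A (x + (a.2 i : ℤ)))
    else edgeGf w x
  have hT (N : ℕ) (A B : ℤ → EdgeSeries) (h : ∀ x, AgreeBelow N (A x) (B x)) (x : ℤ) :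
      AgreeBelow (N + 1) (T A x) (T B x) := by
    simp only [T]
    split_ifs
    exacts [.isum fun a => (AgreeBelow.refl _).mul (.prod _ fun i => .X_mul _ (h _)), .refl _]
  let G (x : ℤ) : EdgeSeries := if x ∈ D then eval Y (pieceSeries w D x) else edgeGf w x
  have hG : T G = G := funext fun x => by
    by_cases hx : x ∈ D
    · simp only [T, G, if_pos hx, eval_pieceSeries w hx]
      refine congrArg isum (funext fun a => congrArg _ (Finset.prod_congr rfl fun i _ => ?_))
      split_ifs with hi
      exacts [rfl, hY x hx _ hi]
    · simp only [T, G, if_neg hx]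
  have hedge : T (edgeGf w) = edgeGf w := funext fun x => by
    simp only [T, ← edgeGf_eq, ite_self]
  simpa only [G, if_pos hx] using congrFun (eq_of_contracting hT hedge hG) x

end Cutting

section Splitting

variable (w : Offspring → ℝ≥0∞)

/-- The contribution to `edgeGf w x` of the pieces with labels at most `0`, when there are `y.1`
edges from `0` to `1` and `y.2` edges from `1` to `0`. -/
noncomputable def lowerPart (x : ℤ) (y : ℕ × ℕ) : EdgeSeries :=
  ∑ z ∈ antidiagonal y.1, lagrangeFactor z.1 z.2 •
    (PowerSeries.coeff z.1 (pieceSeries w (Set.Iic 0) x) *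
      PowerSeries.coeff z.2 (pieceSeries w (Set.Iic 0) 0 ^ y.2))

/-- The contribution to `edgeGf w x` of the pieces with labels at least `1`, when there are `y.1`
edges from `0` to `1` and `y.2` edges from `1` to `0`. -/
noncomputable def upperPart (y : ℕ × ℕ) : EdgeSeries :=
  PowerSeries.coeff y.2 (pieceSeries w (Set.Ici 1) 1 ^ y.1)

/-- The edge counts consisting of `y.1` edges from `0` to `1` and `y.2` edges from `1` to `0`. -/
noncomputable def bridgeEdges (y : ℕ × ℕ) : ℤ × SignType →₀ ℕ :=
  Finsupp.single (0, 1) y.1 + Finsupp.single (1, -1) y.2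

theorem edgeGf_of_nonpos {x : ℤ} (hx : x ≤ 0) :
    edgeGf w x = eval (X (0, 1) * edgeGf w 1) (pieceSeries w (Set.Iic 0) x) := by
  refine edgeGf_eq_eval_pieceSeries w (fun x hx ε hε => ?_) hx
  obtain ⟨rfl, rfl⟩ : x = 0 ∧ ε = 1 := by
    rw [Set.mem_Iic] at hx hε
    cases ε <;> simp at hε ⊢ <;> omega
  rfl

theorem edgeGf_one :
    edgeGf w 1 = eval (X (1, -1) * edgeGf w 0) (pieceSeries w (Set.Ici 1) 1) := by
  refine edgeGf_eq_eval_pieceSeries w (fun x hx ε hε => ?_) (Set.mem_Ici.2 le_rfl)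
  obtain ⟨rfl, rfl⟩ : x = 1 ∧ ε = -1 := by
    rw [Set.mem_Ici] at hx hε
    cases ε <;> simp at hε ⊢ <;> omega
  rfl

theorem edgeGf_eq_isum {x : ℤ} (hx : x ≤ 0) :
    edgeGf w x = isum fun y : ℕ × ℕ =>
      lowerPart w x y * upperPart w y * MvPowerSeries.monomial (bridgeEdges y) 1 := by
  have hV : X (0, 1) * edgeGf w 1 = X (0, 1) *
      eval (X (1, -1) * eval (X (0, 1) * edgeGf w 1) (pieceSeries w (Set.Iic 0) 0))
        (pieceSeries w (Set.Ici 1) 1) := by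
    rw [← edgeGf_of_nonpos w le_rfl, ← edgeGf_one]
  have monomial_eq (y : ℕ × ℕ) : MvPowerSeries.monomial (bridgeEdges y) (1 : ℝ≥0∞) =
      X (0, 1) ^ y.1 * X (1, -1) ^ y.2 := by
    simp [bridgeEdges, MvPowerSeries.X_pow_eq, MvPowerSeries.monomial_mul_monomial]
  rw [edgeGf_of_nonpos w hx, eval_eq_isum_of_eq_X_mul_eval hV]
  simp only [monomial_eq, mul_assoc]
  rfl

/-- The edge counts in which only edges with both ends in `D` occur. -/
def innerEdges (D : Set ℤ) : AddSubmonoid (ℤ × SignType →₀ ℕ) where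
  carrier := {s | ∀ e : ℤ × SignType, ¬ (e.1 ∈ D ∧ e.1 + (e.2 : ℤ) ∈ D) → s e = 0}
  add_mem' hs ht e he := by rw [Finsupp.add_apply, hs e he, ht e he]
  zero_mem' _ _ := rfl

theorem pieceSeries_mem (D : Set ℤ) (x : ℤ) :
    pieceSeries w D x ∈ coeffsIn (supportedOn (innerEdges D)) := by
  classical
  refine partitionFunction_mem (R := PowerSeries EdgeSeries)
    (fun _ => isum_mem_coeffsIn fun _ => isum_mem_supportedOn) (fun x a => ?_) x
  rw [pieceWeight]
  split_ifs with hx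
  · refine mul_mem (C_mem_coeffsIn (monomial_mem_supportedOn (zero_mem _) _))
      (prod_mem fun i _ => ?_)
    split_ifs with hi
    · refine C_mem_coeffsIn (monomial_mem_supportedOn (fun e he => ?_) _)
      exact Finsupp.single_eq_of_ne fun h => he (h ▸ ⟨hx, hi⟩)
    · exact X_mem_coeffsIn _
  · exact one_mem _
  · exact zero_mem _

theorem lowerPart_mem (x : ℤ) (y : ℕ × ℕ) :
    lowerPart w x y ∈ supportedOn (innerEdges (Set.Iic 0)) :=
  sum_mem fun _ _ => smul_mem_supportedOn _
    (mul_mem (pieceSeries_mem w _ _ _) (pow_mem (pieceSeries_mem w _ _) _ _))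

theorem upperPart_mem (y : ℕ × ℕ) : upperPart w y ∈ supportedOn (innerEdges (Set.Ici 1)) :=
  pow_mem (pieceSeries_mem w _ _) _ _

/-- The numbers of edges from `j` to `j + 1` and from `j + 1` to `j`. -/
def crossings (s : ℤ × SignType →₀ ℕ) (j : ℤ) : ℕ × ℕ := (s (j, 1), s (j + 1, -1))

/-- The crossings below the level between `0` and `1`, going down. -/
def crossingsBelow (s : ℤ × SignType →₀ ℕ) (j : ℕ) : ℕ × ℕ := crossings s (-(j + 1))

/-- The crossings above the level between `0` and `1`, going up. -/
def crossingsAbove (s : ℤ × SignType →₀ ℕ) (j : ℕ) : ℕ × ℕ := crossings s (j + 1)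

theorem crossings_add (s t : ℤ × SignType →₀ ℕ) (j : ℤ) :
    crossings (s + t) j = crossings s j + crossings t j := rfl

theorem crossings_eq_zero {D : Set ℤ} {s : ℤ × SignType →₀ ℕ} (hs : s ∈ innerEdges D) {j : ℤ}
    (hj : ¬ (j ∈ D ∧ j + 1 ∈ D)) : crossings s j = 0 :=
  Prod.ext (hs _ hj) (hs _ fun h => hj ⟨by simpa using h.2, h.1⟩)

theorem crossings_bridgeEdges_zero (y : ℕ × ℕ) : crossings (bridgeEdges y) 0 = y := by
  simp [crossings, bridgeEdges]

theorem crossings_bridgeEdges_of_ne (y : ℕ × ℕ) {j : ℤ} (hj : j ≠ 0) :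
    crossings (bridgeEdges y) j = 0 := by
  simp [crossings, bridgeEdges, hj]

theorem coeffMass_lowerPart_mul_upperPart (x : ℤ) (y z : ℕ × ℕ) (A B : Set (ℕ → ℕ × ℕ)) :
    coeffMass (lowerPart w x z * upperPart w z) {s | crossings (s + bridgeEdges z) 0 = y ∧
        crossingsBelow (s + bridgeEdges z) ∈ A ∧ crossingsAbove (s + bridgeEdges z) ∈ B} =
      coeffMass (lowerPart w x z) {s | z = y ∧ crossingsBelow s ∈ A} *
        coeffMass (upperPart w z) (crossingsAbove ⁻¹' B) := by
  refine coeffMass_mul fun a b ha hb => ?_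
  replace ha := lowerPart_mem w x z a ha
  replace hb := upperPart_mem w z b hb
  have level : crossings (a + b + bridgeEdges z) 0 = z := by
    rw [crossings_add, crossings_add, crossings_eq_zero ha (by simp),
      crossings_eq_zero hb (by simp), crossings_bridgeEdges_zero, zero_add, zero_add]
  have below : crossingsBelow (a + b + bridgeEdges z) = crossingsBelow a := funext fun j => by
    rw [crossingsBelow, crossings_add, crossings_add,
      crossings_eq_zero hb fun h => by have := Set.mem_Ici.1 h.1; omega,
      crossings_bridgeEdges_of_ne _ (by omega), add_zero, add_zero]
    rfl
  have above : crossingsAbove (a + b + bridgeEdges z) = crossingsAbove b := funext fun j => by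
    rw [crossingsAbove, crossings_add, crossings_add,
      crossings_eq_zero ha fun h => by have := Set.mem_Iic.1 h.1; omega,
      crossings_bridgeEdges_of_ne _ (by omega), zero_add, add_zero]
    rfl
  simp only [Set.mem_ofPred_eq, Set.mem_preimage, level, below, above, and_assoc]

theorem coeffMass_edgeGf {x : ℤ} (hx : x ≤ 0) (y : ℕ × ℕ) (A B : Set (ℕ → ℕ × ℕ)) :
    coeffMass (edgeGf w x) {s | crossings s 0 = y ∧ crossingsBelow s ∈ A ∧ crossingsAbove s ∈ B} =
      coeffMass (lowerPart w x y) (crossingsBelow ⁻¹' A) *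
        coeffMass (upperPart w y) (crossingsAbove ⁻¹' B) := by
  simp only [edgeGf_eq_isum w hx, coeffMass_isum, coeffMass_mul_monomial, Set.mem_ofPred_eq,
    coeffMass_lowerPart_mul_upperPart]
  rw [tsum_eq_single y fun z hz => by simp [hz, coeffMass]]
  simp only [true_and]
  rfl

end Splitting

section Edges

/-- The numbers of edges of all types, when the root has label `x`. -/
noncomputable def edges : ℤ → LabelledPlaneTree → (ℤ × SignType →₀ ℕ)
  | x, node _ δ c => ∑ i, (Finsupp.single (x, δ i) 1 + edges (x + (δ i : ℤ)) (c i))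

theorem edges_apply (a : ℤ) (ε : SignType) (t : LabelledPlaneTree) (x : ℤ) :
    edges x t (a, ε) = edgeCount a (a + (ε : ℤ)) x t := by
  induction t generalizing x with
  | node k δ c ih =>
    rw [edgeCount, edges, Finsupp.finsetSum_apply]
    refine Finset.sum_congr rfl fun i _ => ?_
    rw [Finsupp.add_apply, ih, Finsupp.single_apply]
    have coe_inj {ε ε' : SignType} : (ε : ℤ) = ε' ↔ ε = ε' := by
      cases ε <;> cases ε' <;> simp
    congr 1
    refine if_congr ?_ rfl rfl
    rw [Prod.mk.injEq, and_congr_right_iff]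
    rintro rfl
    rw [add_right_inj, coe_inj]

theorem edgeCount_add (r a b : ℤ) (t : LabelledPlaneTree) (x : ℤ) :
    edgeCount (a + r) (b + r) (x + r) t = edgeCount a b x t := by
  induction t generalizing x with
  | node k δ c ih =>
    rw [edgeCount, edgeCount]
    refine Finset.sum_congr rfl fun i _ => ?_
    rw [add_right_comm, ih]
    simp only [add_left_inj]

theorem crossings_edges (x : ℤ) (t : LabelledPlaneTree) (j : ℤ) :
    crossings (edges x t) j = (edgeCount j (j + 1) x t, edgeCount (j + 1) j x t) := by
  simp only [crossings, edges_apply, SignType.coe_one, SignType.coe_neg_one, add_neg_cancel_right]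

theorem posProcess_eq_crossings (n : ℕ) (t : LabelledPlaneTree) (j : ℕ) :
    posProcess t j = crossings (edges (-n) t) (j - n) := by
  rw [crossings_edges, posProcess, Xplus, Xminus, ← edgeCount_add (-n) _ _ _ 0,
    ← edgeCount_add (-n) ((j + 1 : ℕ) : ℤ) _ _ 0]
  simp only [zero_sub, Nat.cast_succ, add_sub_cancel_right, ← sub_eq_add_neg, sub_add_eq_add_sub]

theorem negProcess_eq_crossingsBelow (t : LabelledPlaneTree) (j : ℕ) :
    negProcess t j = (crossingsBelow (edges 0 t) j).swap := by
  rw [crossingsBelow, crossings_edges, negProcess, XcheckMinus, XcheckPlus]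
  push_cast
  rfl

end Edges

section Law

variable (ξ : PMF ℕ) (η : ∀ k : ℕ, PMF (Fin k → SignType))

/-- The probability that a vertex has a given offspring. -/
noncomputable def vertexWeight (a : Offspring) : ℝ≥0∞ := ξ a.1 * η a.1 a.2

theorem treeWeight_edgeWeight (x : ℤ) (t : LabelledPlaneTree) :
    treeWeight (edgeWeight (vertexWeight ξ η)) x t =
      MvPowerSeries.monomial (edges x t) (weight ξ η t) := by
  induction t generalizing x with
  | node k δ c ih =>
    simp only [treeWeight, edgeWeight, vertexWeight, ih, weight, edges, mul_assoc]
    rw [← Finset.prod_mul_distrib, ← MvPowerSeries.monomial_zero_eq_C_apply]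
    simp only [X, MvPowerSeries.monomial_mul_monomial, MvPowerSeries.prod_monomial, one_mul,
      zero_add, mul_assoc]

theorem law_apply (A : Set LabelledPlaneTree) :
    law ξ η A = ∑' t, A.indicator (weight ξ η) t := by
  rw [law, Measure.sum_apply _ MeasurableSpace.measurableSet_top]
  refine tsum_congr fun t => ?_
  rw [Measure.smul_apply, Measure.dirac_apply' _ MeasurableSpace.measurableSet_top, smul_eq_mul]
  by_cases h : t ∈ A <;> simp [h]

theorem law_edges_mem (x : ℤ) (A : Set (ℤ × SignType →₀ ℕ)) :
    law ξ η {t | edges x t ∈ A} = coeffMass (edgeGf (vertexWeight ξ η) x) A := by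
  rw [edgeGf, partitionFunction, coeffMass_isum, law_apply]
  simp only [treeWeight_edgeWeight, coeffMass_monomial]
  rfl

theorem law_crossings {x : ℤ} (hx : x ≤ 0) (y : ℕ × ℕ) (A B : Set (ℕ → ℕ × ℕ)) :
    law ξ η {t | crossings (edges x t) 0 = y ∧ crossingsBelow (edges x t) ∈ A ∧
        crossingsAbove (edges x t) ∈ B} =
      coeffMass (lowerPart (vertexWeight ξ η) x y) (crossingsBelow ⁻¹' A) *
        coeffMass (upperPart (vertexWeight ξ η) y) (crossingsAbove ⁻¹' B) :=
  (law_edges_mem ξ η x _).trans (coeffMass_edgeGf _ hx y A B)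

end Law

section TotalMass

variable (ξ : PMF ℕ) (η : ∀ k : ℕ, PMF (Fin k → SignType))

theorem tsum_tree {F G : LabelledPlaneTree → ℝ≥0∞}
    (hF : ∀ k δ c, F (node k δ c) = ξ k * η k δ * ∏ i, G (c i)) :
    ∑' t, F t = ∑' k, ξ k * (∑' t, G t) ^ k := by
  rw [← isum_eq_tsum, isum_tree (K := vertexWeight ξ η) (G := fun _ _ => G) hF, isum_sigma]
  simp only [vertexWeight, isum_eq_tsum, Finset.prod_const, Finset.card_univ, Fintype.card_fin,
    ENNReal.tsum_mul_left, ENNReal.tsum_mul_right]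
  exact tsum_congr fun k => by rw [(η k).tsum_coe, mul_one]

/-- The weight of a tree if its height is less than `h`, and `0` otherwise. -/
noncomputable def truncatedWeight : ℕ → LabelledPlaneTree → ℝ≥0∞
  | 0, _ => 0
  | h + 1, node k δ c => ξ k * η k δ * ∏ i, truncatedWeight h (c i)

theorem tsum_truncatedWeight_le_one (h : ℕ) : ∑' t, truncatedWeight ξ η h t ≤ 1 := by
  induction h with
  | zero => simp [truncatedWeight]
  | succ h ih =>
    rw [tsum_tree ξ η (G := truncatedWeight ξ η h) fun k δ c => by rw [truncatedWeight]]
    calc ∑' k, ξ k * (∑' t, truncatedWeight ξ η h t) ^ k ≤ ∑' k, ξ k :=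
          ENNReal.tsum_le_tsum fun k => mul_le_of_le_one_right' (pow_le_one' ih k)
      _ = 1 := ξ.tsum_coe

theorem eventually_truncatedWeight_eq (t : LabelledPlaneTree) :
    ∀ᶠ h in Filter.atTop, truncatedWeight ξ η h t = weight ξ η t := by
  induction t with
  | node k δ c ih =>
    rw [← Filter.map_add_atTop_eq_nat 1, Filter.eventually_map]
    filter_upwards [Filter.eventually_all.2 ih] with h hh
    simp only [truncatedWeight, weight, hh]

theorem tsum_weight_le_one : ∑' t, weight ξ η t ≤ 1 := by
  rw [ENNReal.tsum_eq_iSup_sum]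
  refine iSup_le fun F => ?_
  obtain ⟨h, hh⟩ := ((Filter.eventually_all_finset F).2 fun t _ =>
    eventually_truncatedWeight_eq ξ η t).exists
  calc ∑ t ∈ F, weight ξ η t = ∑ t ∈ F, truncatedWeight ξ η h t :=
        Finset.sum_congr rfl fun t ht => (hh t ht).symm
    _ ≤ ∑' t, truncatedWeight ξ η h t := ENNReal.sum_le_tsum F
    _ ≤ 1 := tsum_truncatedWeight_le_one ξ η h

theorem law_univ : law ξ η Set.univ = ∑' t, weight ξ η t := by
  rw [law_apply, Set.indicator_univ]

instance : IsFiniteMeasure (law ξ η) :=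
  ⟨(law_univ ξ η).trans_le (tsum_weight_le_one ξ η) |>.trans_lt ENNReal.one_lt_top⟩

theorem isProbabilityMeasure_law (hmean : ∑' k : ℕ, ξ k * (k : ℝ≥0∞) ≤ 1) (hξ : ξ 1 ≠ 1) :
    IsProbabilityMeasure (law ξ η) := by
  refine ⟨(law_univ ξ η).trans ?_⟩
  refine eq_one_of_tsum_mul_pow_eq hmean hξ (tsum_weight_le_one ξ η) ?_
  exact (tsum_tree ξ η fun k δ c => by rw [weight]).symm

end TotalMass

section Processes

variable (ξ : PMF ℕ) (η : ∀ k : ℕ, PMF (Fin k → SignType))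

theorem isTimeHomogeneousMarkovChain_posProcess :
    IsTimeHomogeneousMarkovChain (law ξ η) posProcess := by
  let pastMass (n : ℕ) (y : ℕ → ℕ × ℕ) : ℝ≥0∞ :=
    coeffMass (lowerPart (vertexWeight ξ η) (-n) (y n))
      (crossingsBelow ⁻¹' {b | ∀ i < n, b (n - 1 - i) = y i})
  let nextMass (y z : ℕ × ℕ) : ℝ≥0∞ :=
    coeffMass (upperPart (vertexWeight ξ η) y) (crossingsAbove ⁻¹' {b | b 0 = z})
  refine isTimeHomogeneousMarkovChain_of_measure_eq_mul (q := nextMass)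
    (fun _ _ => MeasurableSpace.measurableSet_top) fun n y => ⟨pastMass n y, fun z => ?_⟩
  -- With the root at label `-n`, the edges counted at time `n` are those between `0` and `1`.
  rw [← law_crossings ξ η (neg_nonpos.2 n.cast_nonneg)]
  congr 1
  ext t
  have present : posProcess t n = crossings (edges (-n) t) 0 := by
    rw [posProcess_eq_crossings n, sub_self]
  have past {i : ℕ} (hi : i < n) :
      posProcess t i = crossingsBelow (edges (-n) t) (n - 1 - i) := by
    rw [posProcess_eq_crossings n, crossingsBelow]
    congr 1
    omega
  have next : posProcess t (n + 1) = crossingsAbove (edges (-n) t) 0 := by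
    rw [posProcess_eq_crossings n, crossingsAbove]
    congr 1
    omega
  have past_iff : (∀ i < n, posProcess t i = y i) ↔
      ∀ i < n, crossingsBelow (edges (-n) t) (n - 1 - i) = y i :=
    forall₂_congr fun i hi => by rw [past hi]
  simp only [Set.mem_ofPred_eq, ← present, ← next, ← past_iff, le_iff_lt_or_eq, or_imp,
    forall_and, forall_eq]
  tauto

theorem indepFun_negProcess_posProcess (y : ℕ × ℕ) :
    IndepFun negProcess posProcess (cond (law ξ η) {t | posProcess t 0 = y}) := by
  refine indepFun_cond_of_measure_inter_eq_mul MeasurableSpace.measurableSet_top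
    (a := fun A => coeffMass (lowerPart (vertexWeight ξ η) 0 y)
      (crossingsBelow ⁻¹' {b | (fun j => (b j).swap) ∈ A}))
    (b := fun B => coeffMass (upperPart (vertexWeight ξ η) y)
      (crossingsAbove ⁻¹' {b | (fun j => Nat.casesOn j y b) ∈ B})) fun A B _ _ => ?_
  rw [← law_crossings ξ η le_rfl]
  congr 1
  ext t
  have below : negProcess t = fun j => (crossingsBelow (edges 0 t) j).swap :=
    funext (negProcess_eq_crossingsBelow t)
  have level (j : ℕ) : posProcess t j = crossings (edges 0 t) j := by
    simpa using posProcess_eq_crossings 0 t j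
  have above (h : crossings (edges 0 t) 0 = y) :
      posProcess t = fun j => Nat.casesOn j y (crossingsAbove (edges 0 t)) := by
    funext j
    cases j with
    | zero => exact (level 0).trans h
    | succ j => exact level (j + 1)
  simp only [Set.mem_inter_iff, Set.mem_preimage, Set.mem_ofPred_eq, below, level 0]
  exact and_congr_right fun h => by rw [above h]

end Processes

section Reflection

/-- The tree with all increments negated. -/
def reflect : LabelledPlaneTree → LabelledPlaneTree
  | node k δ c => node k (fun i => -δ i) fun i => reflect (c i)

theorem reflect_involutive : Function.Involutive reflect := by
  intro t
  induction t with
  | node k δ c ih => simp [reflect, ih]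

theorem edgeCount_reflect (a b x : ℤ) (t : LabelledPlaneTree) :
    edgeCount a b x (reflect t) = edgeCount (-a) (-b) (-x) t := by
  induction t generalizing x with
  | node k δ c ih =>
    rw [reflect, edgeCount, edgeCount]
    refine Finset.sum_congr rfl fun i _ => ?_
    have increment : x + ((-δ i : SignType) : ℤ) = -(-x + (δ i : ℤ)) := by
      rw [SignType.coe_neg, neg_add, neg_neg]
    simp only [ih, increment, neg_inj, neg_neg, neg_eq_iff_eq_neg (b := b)]

theorem posProcess_reflect (t : LabelledPlaneTree) : posProcess (reflect t) = negProcess t := by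
  funext j
  simp only [posProcess, negProcess, Xplus, Xminus, XcheckPlus, XcheckMinus, edgeCount_reflect,
    neg_sub', sub_neg_eq_add, neg_zero]

/-- The displacement laws of the reflected trees. -/
noncomputable def reflectDisplacements (η : ∀ k : ℕ, PMF (Fin k → SignType)) (k : ℕ) :
    PMF (Fin k → SignType) :=
  (η k).map fun δ i => -δ i

variable (ξ : PMF ℕ) (η : ∀ k : ℕ, PMF (Fin k → SignType))

theorem reflectDisplacements_neg {k : ℕ} (δ : Fin k → SignType) :
    reflectDisplacements η k (fun i => -δ i) = η k δ := by
  rw [reflectDisplacements, PMF.map_apply, tsum_eq_single δ, if_pos rfl]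
  intro δ' hne
  exact if_neg fun h => hne (neg_injective h.symm)

theorem weight_reflect (t : LabelledPlaneTree) :
    weight ξ (reflectDisplacements η) (reflect t) = weight ξ η t := by
  induction t with
  | node k δ c ih => simp only [reflect, weight, reflectDisplacements_neg, ih]

theorem law_preimage_reflect (A : Set LabelledPlaneTree) :
    law ξ η (reflect ⁻¹' A) = law ξ (reflectDisplacements η) A := by
  rw [law_apply, law_apply, ← reflect_involutive.toPerm.tsum_eq (A.indicator _)]
  refine tsum_congr fun t => ?_
  rw [Function.Involutive.coe_toPerm, ← Set.indicator_comp_right]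
  exact congrArg (fun f => (reflect ⁻¹' A).indicator f t) (funext (weight_reflect ξ η)).symm

theorem law_negProcess_preimage (A : Set (ℕ → ℕ × ℕ)) :
    law ξ η (negProcess ⁻¹' A) = law ξ (reflectDisplacements η) (posProcess ⁻¹' A) := by
  rw [← law_preimage_reflect, ← Set.preimage_comp]
  exact congrArg (fun f => law ξ η (f ⁻¹' A)) (funext posProcess_reflect).symm

theorem isTimeHomogeneousMarkovChain_negProcess :
    IsTimeHomogeneousMarkovChain (law ξ η) negProcess := by
  obtain ⟨K, hK⟩ := isTimeHomogeneousMarkovChain_posProcess ξ (reflectDisplacements η)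
  have same_law (n : ℕ) (y : ℕ → ℕ × ℕ) : law ξ η {t | ∀ i ≤ n, negProcess t i = y i} =
      law ξ (reflectDisplacements η) {t | ∀ i ≤ n, posProcess t i = y i} :=
    law_negProcess_preimage ξ η {f | ∀ i ≤ n, f i = y i}
  exact ⟨K, fun n y => by rw [same_law, same_law, hK]⟩

theorem identDistrib_negProcess_posProcess (hη : SymmetricDisplacements η) :
    IdentDistrib negProcess posProcess (law ξ η) (law ξ η) := by
  have measurable (f : LabelledPlaneTree → ℕ → ℕ × ℕ) : Measurable f := measurable_from_top
  refine ⟨(measurable _).aemeasurable, (measurable _).aemeasurable, Measure.ext fun A hA => ?_⟩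
  have reflect_eq : reflectDisplacements η = η := funext hη
  rw [Measure.map_apply (measurable _) hA, Measure.map_apply (measurable _) hA,
    law_negProcess_preimage, reflect_eq]

end Reflection

end LabelledPlaneTree

open LabelledPlaneTree in
theorem corollary4p3_general (ξ : PMF ℕ) (η : ∀ k : ℕ, PMF (Fin k → SignType)) :
    (∑' k : ℕ, ξ k * (k : ℝ≥0∞) ≤ 1 → ξ 1 ≠ 1 → IsProbabilityMeasure (law ξ η)) ∧
    IsTimeHomogeneousMarkovChain (law ξ η) negProcess ∧
    IsTimeHomogeneousMarkovChain (law ξ η) posProcess ∧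
    (SymmetricDisplacements η → IdentDistrib negProcess posProcess (law ξ η) (law ξ η)) ∧
    ∀ x : ℕ × ℕ,
      IndepFun negProcess posProcess (cond (law ξ η) {t | (Xplus 1 t, Xminus 1 t) = x}) :=
  ⟨isProbabilityMeasure_law ξ η, isTimeHomogeneousMarkovChain_negProcess ξ η,
    isTimeHomogeneousMarkovChain_posProcess ξ η, identDistrib_negProcess_posProcess ξ η,
    indepFun_negProcess_posProcess ξ η⟩

open LabelledPlaneTree in
theorem corollary4p3 (ξ : PMF ℕ) (hmean : ∑' k : ℕ, ξ k * (k : ℝ≥0∞) ≤ 1) (hξ : ξ 1 ≠ 1)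
    (η : ∀ k : ℕ, PMF (Fin k → SignType)) :
    -- the weights define a probability measure on finite labelled trees
    IsProbabilityMeasure (law ξ η) ∧
    -- both processes are time-homogeneous Markov chains
    IsTimeHomogeneousMarkovChain (law ξ η) negProcess ∧
    IsTimeHomogeneousMarkovChain (law ξ η) posProcess ∧
    -- they have the same law if the displacement laws are symmetric
    (SymmetricDisplacements η → IdentDistrib negProcess posProcess (law ξ η) (law ξ η)) ∧
    -- they are independent conditionally on the value of the pair at level one
    ∀ x : ℕ × ℕ,
      IndepFun negProcess posProcess (cond (law ξ η) {t | (Xplus 1 t, Xminus 1 t) = x}) :=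
  (corollary4p3_general ξ η).imp_left fun isProbabilityMeasure => isProbabilityMeasure hmean hξ
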